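/- Let $n,m\ge 0$ be integers, let $\Delta_n=\operatorname{conv}\{e_1,\dots,e_{n+1}\}\subseteq\mathbb{R}^{n+1}$ be the standard $n$-simplex, and let $m\cdot\Delta_n=\{x\in\mathbb{R}^{n+1} : \sum_i x_i=m,\ x_i\ge 0\}$. Let $T$ be a triangulation of $\Delta_n$, i.e. a finite geometric simplicial complex with underlying space $\Delta_n$ all of whose facets (maximal simplices) are $n$-simplices. A Sperner labeling of $T$ is a map $\lambda$ from the vertices of $T$ to $\{1,\dots,n+1\}$ such that $\lambda(e_1),\dots,\lambda(e_{n+1})$ are pairwise distinct, and such that every vertex of $T$ lying in a face $\operatorname{conv}\{e_i : i\in F\}$ of $\Delta_n$ has a label in $\{\lambda(e_i): i\in F\}$. Let $\lambda_1,\dots,\lambda_m$ be Sperner labelings of $T$ that agree on the original vertices, i.e. $\lambda_k(e_i)=\lambda_{k'}(e_i)$ for all $k,k',i$. Let $y\in m\cdot\Delta_n$ be a point that is not in the convex hull of any $n$ (not necessarily distinct) lattice points of $m\cdot\Delta_n$, where a lattice point is a point with integer coordinates. Then there are a facet $\sigma$ of $T$ and an ordering $v_1,\dots,v_{n+1}$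 of its vertices such that $y\in\operatorname{conv}\{y_1,\dots,y_{n+1}\}$, where $y_i\in m\cdot\Delta_n$ is the lattice point whose $j$-th coordinate is the number of $k\in\{1,\dots,m\}$ with $\lambda_k(v_i)=j$. -/

import Mathlib

/-- The `i`-th vertex `e_i` of the standard `n`-simplex `Δ_n ⊆ ℝ^{n+1}`. -/
def stdVertex (n : ℕ) (i : Fin (n + 1)) : Fin (n + 1) → ℝ :=
  Pi.single i 1

/-- The dilated simplex `m · Δ_n = {x ∈ ℝ^{n+1} | ∑ x_i = m, x_i ≥ 0}`. -/
def scaledSimplex (n m : ℕ) : Set (Fin (n + 1) → ℝ) :=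
  {x | (∀ i, 0 ≤ x i) ∧ ∑ i, x i = (m : ℝ)}

/-- The lattice points (points with integer coordinates) of `m · Δ_n`. -/
def latticePoints (n m : ℕ) : Set (Fin (n + 1) → ℝ) :=
  {x | x ∈ scaledSimplex n m ∧ ∀ i, ∃ z : ℤ, x i = (z : ℝ)}

/-- `T` is a triangulation of the standard `n`-simplex: a finite geometric simplicial complex all of
whose facets are `n`-simplices, and which covers exactly `Δ_n`. -/
structure IsTriangulation (n : ℕ) (T : Geometry.SimplicialComplex ℝ (Fin (n + 1) → ℝ)) : Prop where
  finite : T.faces.Finite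
  pure : ∀ s ∈ T.facets, s.card = n + 1
  space_eq : T.space = stdSimplex ℝ (Fin (n + 1))

/-- `l` is a Sperner labeling of `T` by the `n + 1` labels in `Fin (n + 1)` (only the values of `l`
at the vertices of `T` matter): the original vertices `e_i` get pairwise distinct labels, and a
vertex of `T` in the face of `Δ_n` spanned by `{e_i | i ∈ F}` gets the label of some `e_i`,
`i ∈ F`. -/
structure IsSpernerLabeling {n : ℕ} (T : Geometry.SimplicialComplex ℝ (Fin (n + 1) → ℝ))
    (l : (Fin (n + 1) → ℝ) → Fin (n + 1)) : Prop where
  distinct : Function.Injective fun i => l (stdVertex n i)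
  mem_face : ∀ F : Finset (Fin (n + 1)), ∀ v ∈ T.vertices,
    v ∈ convexHull ℝ (stdVertex n '' (F : Set (Fin (n + 1)))) →
      ∃ i ∈ F, l v = l (stdVertex n i)

/-- The point of `ℝ^{n+1}` whose `j`-th coordinate is the number of labelings `L 1, …, L m` that
give `v` the label `j`. -/
def labelCount {n m : ℕ} (L : Fin m → (Fin (n + 1) → ℝ) → Fin (n + 1))
    (v : Fin (n + 1) → ℝ) : Fin (n + 1) → ℝ :=
  fun j => ((Finset.univ.filter fun k => L k v = j).card : ℝ)

/-! Extend `labelCount L` from the vertices of `T` to a piecewise linear map on the simplex. The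
Sperner condition sends the facet `x i = 0` into the facet `z (π i) = 0`, where `π` is the common
labeling of the original vertices. Such a map is onto the dilated simplex (`exists_mem_plGraph`), so
`y` is a convex combination of the values at the vertices of one simplex, hence of a facet.

Surjectivity comes from a KKM-type covering lemma, `exists_mem_of_closed_cover`, applied to the sets
where coordinate `π i` of the image is at most that of `y`: at a common point the image is at most
`y` and has the same coordinate sum. The covering lemma is a compactness limit of Scarf's lemma
(`exists_rainbow_isDominant`), whose proof counts doors modulo two. -/

/-- A finite set `σ` is dominant for a family of rankings `r i` if no point beats all of `σ` in every
ranking at once. -/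
def IsDominant {I V α : Type*} [LE α] (r : I → V → α) (σ : Finset V) : Prop :=
  ∀ y, ∃ i, ∀ x ∈ σ, r i y ≤ r i x

/-! ### Dominant sets and their pseudomanifold structure. -/

section Scarf

variable {I V α : Type*} [LinearOrder α] {r : I → V → α}

theorem IsDominant.mono {σ τ : Finset V} (h : IsDominant r σ) (hτ : τ ⊆ σ) : IsDominant r τ :=
  fun y => (h y).imp fun _ hi x hx => hi x (hτ hx)

/-- A choice of a ranking in which a given element of a dominant set is minimal. -/
theorem IsDominant.exists_injOn (hr : ∀ i, Function.Injective (r i)) {σ : Finset V}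
    (h : IsDominant r σ) :
    ∃ g : V → I, Set.InjOn g σ ∧ ∀ y, ∀ x ∈ σ, r (g y) y ≤ r (g y) x := by
  choose g hg using h
  refine ⟨g, fun x hx y hy hxy => ?_, hg⟩
  have h1 := hg x y hy
  have h2 := hg y x hx
  rw [← hxy] at h2
  exact hr _ (le_antisymm h1 h2)

variable [Fintype I]

/-- When `σ` has as many elements as there are rankings, the injection `g` is a bijection from `σ`
onto the rankings, and each ranking has only one minimal element. -/
theorem IsDominant.index_unique (hr : ∀ i, Function.Injective (r i)) {σ : Finset V}
    (h : IsDominant r σ) (hc : σ.card = Fintype.card I) {x : V} (hx : x ∈ σ) {i j : I}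
    (hi : ∀ z ∈ σ, r i x ≤ r i z) (hj : ∀ z ∈ σ, r j x ≤ r j z) : i = j := by
  classical
  obtain ⟨g, hg, hm⟩ := h.exists_injOn hr
  have himg : σ.image g = Finset.univ :=
    Finset.eq_univ_of_card _ (by rw [Finset.card_image_of_injOn hg, hc])
  have key : ∀ k, (∀ z ∈ σ, r k x ≤ r k z) → k = g x := by
    intro k hk
    obtain ⟨y, hy, rfl⟩ := Finset.mem_image.1 (himg ▸ Finset.mem_univ k)
    rw [hr _ (le_antisymm (hk y hy) (hm y x hx))]
  rw [key i hi, key j hj]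

variable [Finite V] [DecidableEq V]

/-- A subset with one element fewer than there are rankings extends in exactly one way to a dominant
set by a new element that is minimal in a prescribed redundant ranking `a`. -/
theorem existsUnique_insert_isDominant (hr : ∀ i, Function.Injective (r i)) {τ : Finset V}
    (h : IsDominant r τ) (hc : τ.card + 1 = Fintype.card I) {a : I}
    (ha : ∀ z ∈ τ, ∃ j, j ≠ a ∧ ∀ x ∈ τ, r j z ≤ r j x)
    (hne : ∃ y, ∀ j, j ≠ a → ∃ x ∈ τ, r j x < r j y) :
    ∃! x, x ∉ τ ∧ IsDominant r (insert x τ) ∧ ∀ z ∈ τ, r a x < r a z := by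
  classical
  have := Fintype.ofFinite V
  refine existsUnique_of_exists_of_unique ?_ ?_
  -- The filtered points are those for which only ranking `a` can witness dominance; the highest of
  -- them in that ranking is the point to add.
  · obtain ⟨x, hx, hmax⟩ := Finset.exists_max_image
      (Finset.univ.filter fun y => ∀ j, j ≠ a → ∃ x ∈ τ, r j x < r j y) (r a)
      (by simpa [Finset.Nonempty] using hne)
    simp only [Finset.mem_filter, Finset.mem_univ, true_and] at hx hmax
    have hxτ : x ∉ τ := by
      intro hxτ
      obtain ⟨j, hj, hj'⟩ := ha x hxτ
      obtain ⟨z, hz, hlt⟩ := hx j hj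
      exact absurd (hj' z hz) (not_le.2 hlt)
    have hxa : ∀ z ∈ τ, r a x < r a z := by
      intro z hz
      obtain ⟨i, hi⟩ := h x
      have hia : i = a := by
        by_contra hia
        obtain ⟨w, hw, hlt⟩ := hx i hia
        exact absurd (hi w hw) (not_le.2 hlt)
      subst hia
      refine lt_of_le_of_ne (hi z hz) fun he => hxτ ?_
      rwa [hr _ he]
    refine ⟨x, hxτ, fun y => ?_, hxa⟩
    by_cases hy : ∀ j, j ≠ a → ∃ x ∈ τ, r j x < r j y
    · refine ⟨a, fun z hz => ?_⟩
      rcases Finset.mem_insert.1 hz with rfl | hz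
      · exact hmax y hy
      · exact (hmax y hy).trans (hxa z hz).le
    · push Not at hy
      obtain ⟨j, hj, hjy⟩ := hy
      refine ⟨j, fun z hz => ?_⟩
      rcases Finset.mem_insert.1 hz with rfl | hz
      · obtain ⟨w, hw, hlt⟩ := hx j hj
        exact (hjy w hw).trans hlt.le
      · exact hjy z hz
  · have key : ∀ x x', (x ∉ τ ∧ IsDominant r (insert x τ) ∧ ∀ z ∈ τ, r a x < r a z) →
        (x' ∉ τ ∧ IsDominant r (insert x' τ) ∧ ∀ z ∈ τ, r a x' < r a z) → r a x ≤ r a x' := by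
      rintro x x' ⟨hx, hd, hm⟩ ⟨hx', hd', hm'⟩
      obtain ⟨i, hi⟩ := hd' x
      have hia : i = a := by
        refine hd.index_unique hr (by rw [Finset.card_insert_of_notMem hx, hc])
          (Finset.mem_insert_self x τ) (fun z hz => ?_) (fun z hz => ?_)
        · rcases Finset.mem_insert.1 hz with rfl | hz
          · exact le_rfl
          · exact hi z (Finset.mem_insert_of_mem hz)
        · rcases Finset.mem_insert.1 hz with rfl | hz
          · exact le_rfl
          · exact (hm z hz).le
      subst hia
      exact hi x' (Finset.mem_insert_self _ _)
    intro x x' hx hx'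
    exact hr a (le_antisymm (key x x' hx hx') (key x' x hx' hx))

/-- The pseudomanifold property: an interior door belongs to exactly two rooms. -/
theorem exists_pair_insert_isDominant (hr : ∀ i, Function.Injective (r i)) {τ : Finset V}
    (h : IsDominant r τ) (hc : τ.card + 1 = Fintype.card I) (hτ : τ.Nonempty)
    (hne : ∀ a, ∃ y, ∀ j, j ≠ a → ∃ x ∈ τ, r j x < r j y) :
    ∃ p q, p ≠ q ∧ ∀ x, (x ∉ τ ∧ IsDominant r (insert x τ)) ↔ x = p ∨ x = q := by
  classical
  obtain ⟨g, hg, hm⟩ := h.exists_injOn hr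
  obtain ⟨a, ha⟩ : ∃ a, a ∉ τ.image g := by
    by_contra! hall
    have := Finset.card_image_of_injOn hg
    rw [Finset.eq_univ_of_forall hall, Finset.card_univ] at this
    omega
  have himg : ∀ i, i ≠ a → ∃ z ∈ τ, g z = i := by
    intro i hi
    by_contra! hall
    have h2 : (insert a (insert i (τ.image g))).card ≤ Fintype.card I := Finset.card_le_univ _
    rw [Finset.card_insert_of_notMem, Finset.card_insert_of_notMem,
      Finset.card_image_of_injOn hg] at h2
    · omega
    · simpa using hall
    · simp only [Finset.mem_insert, not_or]
      exact ⟨fun e => hi e.symm, ha⟩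
  -- The element `u` is minimal in two rankings, `g u` and the unassigned `a`. Either one may be
  -- handed to a new element, which gives the two rooms.
  obtain ⟨u, hu, hua⟩ := Finset.exists_min_image τ (r a) hτ
  have hab : g u ≠ a := fun e => ha (e ▸ Finset.mem_image_of_mem g hu)
  obtain ⟨p, hp, hpu⟩ := existsUnique_insert_isDominant hr h hc (a := a)
    (fun z hz => ⟨g z, fun e => ha (e ▸ Finset.mem_image_of_mem g hz), hm z⟩) (hne a)
  obtain ⟨q, hq, hqu⟩ := existsUnique_insert_isDominant hr h hc (a := g u)
    (fun z hz => by
      by_cases hzu : z = u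
      · exact ⟨a, hab.symm, hzu ▸ hua⟩
      · exact ⟨g z, fun e => hzu (hg hz hu e), hm z⟩) (hne (g u))
  have hmin : ∀ i x, (∀ z ∈ τ, r i x < r i z) → ∀ z ∈ insert x τ, r i x ≤ r i z := by
    intro i x hx z hz
    rcases Finset.mem_insert.1 hz with rfl | hz
    · exact le_rfl
    · exact (hx z hz).le
  refine ⟨p, q, ?_, fun x => ⟨?_, ?_⟩⟩
  · rintro rfl
    exact hab ((hp.2.1.index_unique hr (by rw [Finset.card_insert_of_notMem hp.1, hc])
      (Finset.mem_insert_self _ _) (hmin _ _ hp.2.2) (hmin _ _ hq.2.2)).symm)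
  · rintro ⟨hx, hd⟩
    obtain ⟨i, hi⟩ := hd x
    have hlt : ∀ z ∈ τ, r i x < r i z := fun z hz =>
      lt_of_le_of_ne (hi z (Finset.mem_insert_of_mem hz)) fun e => hx (by rwa [hr _ e])
    by_cases hia : i = a
    · subst hia
      exact Or.inl (hpu x ⟨hx, hd, hlt⟩)
    by_cases hib : i = g u
    · subst hib
      exact Or.inr (hqu x ⟨hx, hd, hlt⟩)
    -- Otherwise `x` takes the only ranking in which some `z ≠ u` is minimal, leaving `z` with none.
    exfalso
    obtain ⟨z, hz, rfl⟩ := himg i hia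
    obtain ⟨j, hj⟩ := hd z
    have hja : j ≠ a := by
      rintro rfl
      have := hr _ (le_antisymm (hj u (Finset.mem_insert_of_mem hu)) (hua z hz))
      exact hib (by rw [this])
    obtain ⟨z', hz', rfl⟩ := himg j hja
    have := hr _ (le_antisymm (hj z' (Finset.mem_insert_of_mem hz')) (hm z' z hz))
    subst this
    exact absurd (hj x (Finset.mem_insert_self _ _)) (not_le.2 (hlt z hz))
  · rintro (rfl | rfl)
    · exact ⟨hp.1, hp.2.1⟩
    · exact ⟨hq.1, hq.2.1⟩

end Scarf

/-! ### Parity of the number of doors of a simplex. -/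

section Parity

variable {I V : Type*} [Fintype I] [DecidableEq I] [DecidableEq V]

/-- A simplex with an odd number of doors, i.e. codimension-one faces carrying exactly the colours
other than `i₀`, is rainbow. -/
theorem image_eq_univ_of_not_even_card_doors (c : V → I) (i₀ : I) {σ : Finset V}
    (hc : σ.card = Fintype.card I)
    (hodd : ¬ Even (σ.filter fun x => (σ.erase x).image c = Finset.univ.erase i₀).card) :
    σ.image c = Finset.univ := by
  by_contra hne
  apply hodd
  rcases Finset.eq_empty_or_nonempty
    (σ.filter fun x => (σ.erase x).image c = Finset.univ.erase i₀) with h0 | ⟨x, hx⟩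
  · simp [h0]
  obtain ⟨hxσ, hx⟩ := Finset.mem_filter.1 hx
  have hinj : Set.InjOn c (σ.erase x : Finset V) := by
    apply Finset.injOn_of_card_image_eq
    rw [hx, Finset.card_erase_of_mem (Finset.mem_univ _), Finset.card_erase_of_mem hxσ, hc,
      Finset.card_univ]
  have hcx : c x ≠ i₀ := by
    intro e
    apply hne
    rw [← Finset.insert_erase hxσ, Finset.image_insert, hx, e,
      Finset.insert_erase (Finset.mem_univ _)]
  obtain ⟨w, hw, hwx⟩ : ∃ w ∈ σ.erase x, c w = c x := by
    rw [← Finset.mem_image, hx]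
    simpa using hcx
  have hwx' : w ≠ x := Finset.ne_of_mem_erase hw
  have hwσ : w ∈ σ := Finset.mem_of_mem_erase hw
  -- The colour of `x` occurs exactly twice in `σ`, at `x` and `w`; only removing one of these two
  -- leaves all colours but `i₀`.
  suffices (σ.filter fun x => (σ.erase x).image c = Finset.univ.erase i₀) = {x, w} by
    rw [this, Finset.card_pair hwx'.symm]
    exact even_two
  ext z
  simp only [Finset.mem_filter, Finset.mem_insert, Finset.mem_singleton]
  constructor
  · rintro ⟨hz, hzi⟩
    by_contra! hcon
    have : c z ∈ (σ.erase z).image c := by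
      rw [hzi, ← hx]
      exact Finset.mem_image_of_mem c (Finset.mem_erase.2 ⟨hcon.1, hz⟩)
    obtain ⟨t, ht, htz⟩ := Finset.mem_image.1 this
    by_cases htx : t = x
    · subst htx
      exact hcon.2 (hinj (Finset.mem_erase.2 ⟨hcon.1, hz⟩) hw (htz.symm.trans hwx.symm))
    · exact Finset.ne_of_mem_erase ht (hinj
        (Finset.mem_erase.2 ⟨htx, Finset.mem_of_mem_erase ht⟩)
        (Finset.mem_erase.2 ⟨hcon.1, hz⟩) htz)
  · rintro (rfl | rfl)
    · exact ⟨hxσ, hx⟩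
    · refine ⟨hwσ, ?_⟩
      rw [← hx]
      ext k
      simp only [Finset.mem_image, Finset.mem_erase]
      constructor
      · rintro ⟨t, ⟨ht, htσ⟩, rfl⟩
        by_cases htx : t = x
        · exact ⟨z, ⟨hwx', hwσ⟩, by rw [hwx, htx]⟩
        · exact ⟨t, ⟨htx, htσ⟩, rfl⟩
      · rintro ⟨t, ⟨ht, htσ⟩, rfl⟩
        by_cases htw : t = z
        · exact ⟨x, ⟨hwx'.symm, hxσ⟩, by rw [htw, hwx]⟩
        · exact ⟨t, ⟨htw, htσ⟩, rfl⟩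

end Parity

/-! ### Scarf's lemma and the covering lemma derived from it. -/

/-- **Scarf's lemma**, in the form with boundary points `d i`. -/
theorem exists_rainbow_isDominant {I V α : Type*} [LinearOrder α] [Fintype I] [DecidableEq I]
    [Nonempty I] [Fintype V] [DecidableEq V] {r : I → V → α} (hr : ∀ i, Function.Injective (r i))
    (d : I → V) (hbot : ∀ i x, r i (d i) ≤ r i x)
    (htop : ∀ i j, j ≠ i → ∀ x, x ∉ Set.range d → r i x < r i (d j))
    (hex : ∃ x, x ∉ Set.range d) (c : V → I) (hcd : ∀ i, c (d i) = i) :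
    ∃ σ : Finset V, IsDominant r σ ∧ σ.card = Fintype.card I ∧ σ.image c = Finset.univ := by
  classical
  obtain ⟨i₀⟩ := ‹Nonempty I›
  have hdinj : Function.Injective d := fun i j e => by rw [← hcd i, e, hcd]
  by_contra! hno
  -- Incidences of rooms and doors, a pair `(σ, x)` standing for the door `σ.erase x` of the room
  -- `σ`. Without a rainbow room the count by rooms is even; the count by doors is odd.
  let P : Finset (Finset V × V) := Finset.univ.filter fun p =>
    p.1.card = Fintype.card I ∧ IsDominant r p.1 ∧ p.2 ∈ p.1 ∧
      (p.1.erase p.2).image c = Finset.univ.erase i₀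
  have hPeven : Even P.card := by
    rw [Finset.card_eq_sum_card_fiberwise (f := Prod.fst) (t := Finset.univ) (by simp)]
    refine Finset.even_sum _ fun σ _ => ?_
    by_cases hσ : σ.card = Fintype.card I ∧ IsDominant r σ
    · have h1 := mt (image_eq_univ_of_not_even_card_doors c i₀ hσ.1) (hno σ hσ.2 hσ.1)
      rw [not_not] at h1
      suffices h2 : (P.filter fun p => p.1 = σ).card = _ from h2 ▸ h1
      refine Finset.card_nbij' Prod.snd (fun x => (σ, x)) ?_ ?_ ?_ ?_
      · rintro ⟨s, x⟩ hx
        simp only [P, Finset.coe_filter, Finset.mem_filter, Finset.mem_univ, true_and,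
          Set.mem_ofPred_eq] at hx ⊢
        obtain ⟨⟨-, -, h⟩, rfl⟩ := hx
        exact h
      · intro x hx
        simp only [P, Finset.coe_filter, Finset.mem_filter, Finset.mem_univ, true_and,
          Set.mem_ofPred_eq] at hx ⊢
        exact ⟨⟨hσ.1, hσ.2, hx⟩, trivial⟩
      · rintro ⟨s, x⟩ hx
        have : s = σ := (Finset.mem_filter.1 hx).2
        rw [this]
      · intro x _
        rfl
    · convert Even.zero
      rw [Finset.card_eq_zero, Finset.filter_eq_empty_iff]
      rintro ⟨s, x⟩ hx rfl
      have := (Finset.mem_filter.1 hx).2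
      exact hσ ⟨this.1, this.2.1⟩
  have hfib : ∀ τ : Finset V, (P.filter fun p => p.1.erase p.2 = τ).card =
      (Finset.univ.filter fun x => (x ∉ τ ∧ IsDominant r (insert x τ)) ∧
        τ.card + 1 = Fintype.card I ∧ τ.image c = Finset.univ.erase i₀).card := by
    intro τ
    refine Finset.card_nbij' Prod.snd (fun x => (insert x τ, x)) ?_ ?_ ?_ ?_
    · rintro ⟨s, x⟩ hx
      simp only [P, Finset.coe_filter, Finset.mem_filter, Finset.mem_univ, true_and,
        Set.mem_ofPred_eq] at hx ⊢
      obtain ⟨⟨h1, h2, h3, h4⟩, rfl⟩ := hx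
      refine ⟨⟨Finset.notMem_erase _ _, by rwa [Finset.insert_erase h3]⟩, ?_, h4⟩
      rw [Finset.card_erase_add_one h3, h1]
    · intro x hx
      simp only [P, Finset.coe_filter, Finset.mem_filter, Finset.mem_univ, true_and,
        Set.mem_ofPred_eq] at hx ⊢
      obtain ⟨⟨h1, h2⟩, h3, h4⟩ := hx
      refine ⟨⟨?_, h2, Finset.mem_insert_self _ _, ?_⟩, Finset.erase_insert h1⟩
      · rw [Finset.card_insert_of_notMem h1, h3]
      · rwa [Finset.erase_insert h1]
    · rintro ⟨s, x⟩ hx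
      simp only [P, Finset.coe_filter, Finset.mem_filter, Finset.mem_univ, true_and,
        Set.mem_ofPred_eq] at hx
      obtain ⟨⟨h1, h2, h3, h4⟩, rfl⟩ := hx
      simp only [Finset.insert_erase h3]
    · intro x _
      rfl
  -- The one boundary door. Its only room adds the non-boundary point that is highest in ranking
  -- `i₀`.
  let τ₀ : Finset V := (Finset.univ.erase i₀).image d
  have hPodd : Odd P.card := by
    rw [Finset.card_eq_sum_card_fiberwise (f := fun p => p.1.erase p.2) (t := Finset.univ)
      (by simp), ← Finset.add_sum_erase _ _ (Finset.mem_univ τ₀)]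
    refine Odd.add_even ?_ (Finset.even_sum _ fun τ hτ => ?_)
    · rw [hfib]
      obtain ⟨x, hx, hmax⟩ := Finset.exists_max_image
        (Finset.univ.filter fun x => x ∉ Set.range d) (r i₀) (by simpa [Finset.Nonempty] using hex)
      simp only [Finset.mem_filter, Finset.mem_univ, true_and] at hx hmax
      have hmem : ∀ j, j ≠ i₀ → d j ∈ τ₀ := fun j hj =>
        Finset.mem_image_of_mem d (Finset.mem_erase.2 ⟨hj, Finset.mem_univ _⟩)
      have hlow : ∀ i y, y ∉ Set.range d → r i (d i) < r i y := fun i y hy =>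
        lt_of_le_of_ne (hbot i y) fun e => hy ⟨i, hr i e⟩
      have hself : ∀ y, y ∉ Set.range d → ∀ z, IsDominant r (insert z τ₀) → r i₀ y ≤ r i₀ z := by
        intro y hy z hz
        obtain ⟨i, hi⟩ := hz y
        have : i = i₀ := by
          by_contra hne
          exact absurd (hi (d i) (Finset.mem_insert_of_mem (hmem i hne))) (not_le.2 (hlow i y hy))
        subst this
        exact hi z (Finset.mem_insert_self _ _)
      convert odd_one
      rw [Finset.card_eq_one]
      refine ⟨x, ?_⟩
      ext z
      simp only [Finset.mem_filter, Finset.mem_univ, true_and, Finset.mem_singleton]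
      constructor
      · rintro ⟨⟨h1, h2⟩, -⟩
        have hz : z ∉ Set.range d := by
          rintro ⟨j, rfl⟩
          by_cases hj : j = i₀
          · subst hj
            exact absurd (hself x hx _ h2) (not_le.2 (hlow _ x hx))
          · exact h1 (hmem j hj)
        exact hr i₀ (le_antisymm (hmax z hz) (hself x hx z h2))
      · rintro rfl
        refine ⟨⟨?_, fun y => ?_⟩, ?_, ?_⟩
        · intro hz
          obtain ⟨j, -, rfl⟩ := Finset.mem_image.1 hz
          exact hx ⟨j, rfl⟩
        · by_cases hy : y ∈ Set.range d
          · obtain ⟨j, rfl⟩ := hy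
            exact ⟨j, fun w _ => hbot j w⟩
          · refine ⟨i₀, fun w hw => ?_⟩
            rcases Finset.mem_insert.1 hw with rfl | hw
            · exact hmax y hy
            · obtain ⟨j, hj, rfl⟩ := Finset.mem_image.1 hw
              exact (htop i₀ j (Finset.ne_of_mem_erase hj) y hy).le
        · rw [Finset.card_image_of_injective _ hdinj, Finset.card_erase_add_one (Finset.mem_univ _),
            Finset.card_univ]
        · rw [Finset.image_image]
          have : c ∘ d = id := funext hcd
          rw [this, Finset.image_id]
    · rw [hfib]
      have hτ0 : τ ≠ τ₀ := Finset.ne_of_mem_erase hτ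
      rcases Finset.eq_empty_or_nonempty (Finset.univ.filter fun x =>
        (x ∉ τ ∧ IsDominant r (insert x τ)) ∧
        τ.card + 1 = Fintype.card I ∧ τ.image c = Finset.univ.erase i₀) with h0 | ⟨x, hx⟩
      · rw [h0]
        simp
      obtain ⟨-, ⟨hx, hd⟩, hcard, himg⟩ := Finset.mem_filter.1 hx
      -- A door made of boundary points only is determined by its colours, hence equals `τ₀`. Given
      -- `z`, the point `d a` beats it in every ranking but `a`, so the door is interior.
      obtain ⟨z, hz, hzd⟩ : ∃ z ∈ τ, z ∉ Set.range d := by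
        by_contra! hall
        apply hτ0
        have hid : ∀ z ∈ τ, d (c z) = z := by
          intro z hz
          obtain ⟨j, rfl⟩ := hall z hz
          rw [hcd]
        simp only [τ₀]
        rw [← himg, Finset.image_image]
        ext w
        simp only [Finset.mem_image, Function.comp_apply]
        exact ⟨fun hw => ⟨w, hw, hid w hw⟩, fun ⟨t, ht, e⟩ => by rwa [← e, hid t ht]⟩
      obtain ⟨p, q, hpq, hiff⟩ := exists_pair_insert_isDominant hr
        (hd.mono (Finset.subset_insert _ _)) hcard ⟨z, hz⟩
        (fun a => ⟨d a, fun j hj => ⟨z, hz, htop j a hj.symm z hzd⟩⟩)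
      have : (Finset.univ.filter fun x => (x ∉ τ ∧ IsDominant r (insert x τ)) ∧
          τ.card + 1 = Fintype.card I ∧ τ.image c = Finset.univ.erase i₀) = {p, q} := by
        ext w
        simp only [Finset.mem_filter, Finset.mem_univ, true_and, hiff, hcard, himg, and_true,
          Finset.mem_insert, Finset.mem_singleton]
      rw [this, Finset.card_pair hpq]
      exact even_two
  exact (Nat.not_even_iff_odd.2 hPodd) hPeven

/-- In a finite set `T` of points of the unit cube coloured by the coordinates, there are a set `C` of
coordinates and points `x k` of colour `k`, for `k ∈ C`, such that every point of `T` is, in some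
coordinate of `C`, at most all of them. -/
theorem exists_coloured_dominant {I : Type*} [Fintype I] [Nonempty I] (T : Finset (I → ℝ))
    (hT : T.Nonempty) (hT0 : ∀ x ∈ T, ∀ i, 0 ≤ x i ∧ x i ≤ 1) (c : (I → ℝ) → I) :
    ∃ (C : Set I) (x : I → I → ℝ), (∀ k, x k ∈ T) ∧ (∀ k ∈ C, c (x k) = k) ∧
      ∀ y ∈ T, ∃ i ∈ C, ∀ k ∈ C, y i ≤ x k i := by
  classical
  let eT := Fintype.equivFin T
  let eI := Fintype.equivFin I
  -- The second component breaks ties. The values `-1` and `2` lie outside `[0, 1]`, so boundary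
  -- point `i` is below `T` in ranking `i` and above it in all others.
  let r : I → (T ⊕ I) → ℝ ×ₗ ℕ := fun i => Sum.elim (fun x => toLex (x.1 i, (eT x : ℕ)))
    fun j => if j = i then toLex (-1, 0) else toLex (2, (eI j : ℕ))
  have hlow : ∀ i (x : T), r i (Sum.inr i) < r i (Sum.inl x) := by
    intro i x
    simp only [r, Sum.elim_inr, Sum.elim_inl, if_true, Prod.Lex.toLex_lt_toLex]
    exact Or.inl (by linarith [(hT0 x x.2 i).1])
  have hhigh : ∀ i j, j ≠ i → ∀ x : T, r i (Sum.inl x) < r i (Sum.inr j) := by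
    intro i j hj x
    simp only [r, Sum.elim_inr, Sum.elim_inl, if_neg hj, Prod.Lex.toLex_lt_toLex]
    exact Or.inl (by linarith [(hT0 x x.2 i).2])
  have hlow' : ∀ i j, j ≠ i → r i (Sum.inr i) < r i (Sum.inr j) := by
    intro i j hj
    obtain ⟨x, hx⟩ := hT
    exact (hlow i ⟨x, hx⟩).trans (hhigh i j hj ⟨x, hx⟩)
  have hr : ∀ i, Function.Injective (r i) := by
    rintro i (x | j) (x' | j') h
    · simp only [r, Sum.elim_inl, EmbeddingLike.apply_eq_iff_eq, Prod.mk.injEq] at h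
      rw [eT.injective (Fin.ext h.2)]
    · by_cases hj : j' = i
      · subst hj
        exact absurd h (hlow _ _).ne'
      · exact absurd h (hhigh _ _ hj _).ne
    · by_cases hj : j = i
      · subst hj
        exact absurd h (hlow _ _).ne
      · exact absurd h (hhigh _ _ hj _).ne'
    · by_cases hj : j = i
      · subst hj
        by_cases hj' : j' = j
        · rw [hj']
        · exact absurd h (hlow' _ _ hj').ne
      · by_cases hj' : j' = i
        · subst hj'
          exact absurd h (hlow' _ _ hj).ne'
        · simp only [r, Sum.elim_inr, if_neg hj, if_neg hj', EmbeddingLike.apply_eq_iff_eq,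
            Prod.mk.injEq] at h
          rw [eI.injective (Fin.ext h.2)]
  obtain ⟨σ, hσ, -, himg⟩ := exists_rainbow_isDominant hr Sum.inr
    (by
      rintro i (x | j)
      · exact (hlow i x).le
      · by_cases hj : j = i
        · rw [hj]
        · exact (hlow' i j hj).le)
    (by
      rintro i j hj (x | k) hx
      · exact hhigh i j hj x
      · exact absurd ⟨k, rfl⟩ hx)
    (by
      obtain ⟨x, hx⟩ := hT
      exact ⟨Sum.inl ⟨x, hx⟩, by simp⟩)
    (Sum.elim (fun x => c x.1) id) (fun _ => rfl)
  have hC : ∀ k, ∃ x ∈ T, Sum.inr k ∉ σ → ∃ h : x ∈ T, Sum.inl ⟨x, h⟩ ∈ σ ∧ c x = k := by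
    intro k
    by_cases hk : Sum.inr k ∈ σ
    · obtain ⟨x, hx⟩ := hT
      exact ⟨x, hx, fun h => absurd hk h⟩
    · obtain ⟨v, hv, hvk⟩ := Finset.mem_image.1 (himg ▸ Finset.mem_univ k)
      rcases v with x | j
      · exact ⟨x, x.2, fun _ => ⟨x.2, hv, hvk⟩⟩
      · simp only [Sum.elim_inr, id] at hvk
        subst hvk
        exact absurd hv hk
  choose x hxT hx using hC
  -- A colour whose boundary point is not in `σ` must be carried by a point of `T`.
  refine ⟨{k | Sum.inr k ∉ σ}, x, hxT, fun k hk => (hx k hk).2.2, fun y hy => ?_⟩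
  obtain ⟨i, hi⟩ := hσ (Sum.inl ⟨y, hy⟩)
  refine ⟨i, fun hiσ => absurd (hi _ hiσ) (not_le.2 (hlow i _)), fun k hk => ?_⟩
  obtain ⟨h, hm, -⟩ := hx k hk
  have := hi _ hm
  simp only [r, Sum.elim_inl, Prod.Lex.toLex_le_toLex] at this
  rcases this with h | h
  · exact h.le
  · exact h.1.le

/-- A dual form of the **Knaster–Kuratowski–Mazurkiewicz lemma**: closed sets `B i` that cover the
standard simplex and such that `B i` contains the facet `x i = 0` have a common point. -/
theorem exists_mem_of_closed_cover {I : Type*} [Fintype I] [Nonempty I] (B : I → Set (I → ℝ))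
    (hB : ∀ i, IsClosed (B i)) (hcov : ∀ x ∈ stdSimplex ℝ I, ∃ i, x ∈ B i)
    (hface : ∀ x ∈ stdSimplex ℝ I, ∀ i, x i = 0 → x ∈ B i) :
    ∃ x ∈ stdSimplex ℝ I, ∀ i, x ∈ B i := by
  classical
  choose! c hc using hcov
  -- The pair `(C, x)` of `exists_coloured_dominant` ranges over a compact space, with `C` encoded
  -- by its indicator. Each `K y` is a closed condition, so the finite case gives one pair that
  -- works for every `y` in the simplex.
  let K₀ : Set ((I → Bool) × (I → I → ℝ)) := {p | ∀ k, p.2 k ∈ stdSimplex ℝ I}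
  let K₁ : Set ((I → Bool) × (I → I → ℝ)) := {p | ∀ k, p.1 k = true → p.2 k ∈ B k}
  let K : (I → ℝ) → Set ((I → Bool) × (I → I → ℝ)) :=
    fun y => {p | ∃ i, p.1 i = true ∧ ∀ k, p.1 k = true → y i ≤ p.2 k i}
  have hK₀ : IsCompact K₀ := by
    have : K₀ = Set.univ ×ˢ Set.pi Set.univ fun _ => stdSimplex ℝ I := by
      ext p
      simp [K₀]
    rw [this]
    exact isCompact_univ.prod (isCompact_univ_pi fun _ => isCompact_stdSimplex ℝ I)
  have hb : ∀ k (b : Bool), IsClosed {p : (I → Bool) × (I → I → ℝ) | p.1 k = b} := fun k b =>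
    isClosed_eq (by fun_prop) continuous_const
  have himp : ∀ k (S : Set ((I → Bool) × (I → I → ℝ))), IsClosed S →
      IsClosed {p : (I → Bool) × (I → I → ℝ) | p.1 k = true → p ∈ S} := by
    intro k S hS
    have : {p : (I → Bool) × (I → I → ℝ) | p.1 k = true → p ∈ S} = {p | p.1 k = false} ∪ S := by
      ext p
      cases h : p.1 k <;> simp [h]
    rw [this]
    exact (hb k false).union hS
  have hK₁ : IsClosed K₁ := by
    simp only [K₁, Set.ofPred_forall]
    exact isClosed_iInter fun k => himp k {p | p.2 k ∈ B k} ((hB k).preimage (by fun_prop))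
  have hK : ∀ y, IsClosed (K y) := by
    intro y
    simp only [K, Set.ofPred_exists]
    refine isClosed_iUnion_of_finite fun i => (hb i true).inter ?_
    change IsClosed {p : (I → Bool) × (I → I → ℝ) | ∀ k, p.1 k = true → y i ≤ p.2 k i}
    simp only [Set.ofPred_forall]
    exact isClosed_iInter fun k => himp k {p | y i ≤ p.2 k i}
      (isClosed_le continuous_const (by fun_prop))
  obtain ⟨⟨C, x⟩, ⟨hx0, hx1⟩, hxK⟩ := (hK₀.inter_right hK₁).inter_iInter_nonempty
    (fun y : stdSimplex ℝ I => K y) (fun y => hK y) (by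
      intro u
      obtain ⟨e, he⟩ : (stdSimplex ℝ I).Nonempty :=
        ⟨_, single_mem_stdSimplex ℝ (Classical.arbitrary I)⟩
      have hmem : ∀ z ∈ insert e (u.image Subtype.val), z ∈ stdSimplex ℝ I := by
        intro z hz
        rcases Finset.mem_insert.1 hz with rfl | hz
        · exact he
        · obtain ⟨w, -, rfl⟩ := Finset.mem_image.1 hz
          exact w.2
      obtain ⟨C, x, hxT, hxc, hdom⟩ := exists_coloured_dominant (insert e (u.image Subtype.val))
        (Finset.insert_nonempty _ _)
        (fun z hz i => mem_Icc_of_mem_stdSimplex (hmem z hz) i) c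
      refine ⟨(fun i => decide (i ∈ C), x), ⟨fun k => hmem _ (hxT k), fun k hk => ?_⟩, ?_⟩
      · have h1 := hc (x k) (hmem _ (hxT k))
        rwa [hxc k (by simpa using hk)] at h1
      · simp only [Set.mem_iInter]
        intro y hy
        obtain ⟨i, hi, h⟩ := hdom y (Finset.mem_insert_of_mem (Finset.mem_image_of_mem _ hy))
        exact ⟨i, by simpa using hi, fun k hk => h k (by simpa using hk)⟩)
  simp only [Set.mem_iInter, Subtype.forall] at hxK
  have hCne : ∃ k, C k = true := by
    obtain ⟨i, hi, -⟩ := hxK _ (single_mem_stdSimplex ℝ (Classical.arbitrary I))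
    exact ⟨i, hi⟩
  let S : Finset I := Finset.univ.filter fun k => C k = true
  have hmemS : ∀ k, k ∈ S ↔ C k = true := fun k => by simp [S]
  have hSne : S.Nonempty := hCne.imp fun k hk => (hmemS k).2 hk
  have hmin : ∀ i, ∃ k ∈ S, ∀ l ∈ S, x k i ≤ x l i := fun i =>
    Finset.exists_min_image S (fun k => x k i) hSne
  choose a haS ha using hmin
  have hx0' : ∀ k, x k ∈ stdSimplex ℝ I := hx0
  -- If the coordinatewise minima over `S` had sum below `1`, raising each by `δ` would give a point
  -- of the simplex exceeding all of them. Hence all `x k` with `k ∈ S` agree on `S` and vanish off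
  -- `S`: they are one point.
  have hsum : 1 ≤ ∑ i ∈ S, x (a i) i := by
    by_contra! hlt
    have hcard : (0 : ℝ) < S.card := by exact_mod_cast hSne.card_pos
    let δ : ℝ := (1 - ∑ i ∈ S, x (a i) i) / S.card
    have hδ : 0 < δ := div_pos (by linarith) hcard
    obtain ⟨i, hi, h⟩ := hxK (fun i => if i ∈ S then x (a i) i + δ else 0) (by
      refine ⟨fun i => ?_, ?_⟩
      · dsimp only
        split_ifs
        · have := (hx0' (a i)).1 i
          linarith
        · exact le_rfl
      · rw [Finset.sum_ite_mem, Finset.univ_inter, Finset.sum_add_distrib, Finset.sum_const,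
          nsmul_eq_mul]
        simp only [δ]
        field_simp
        ring)
    have h2 : (if i ∈ S then x (a i) i + δ else 0) ≤ x (a i) i := h (a i) ((hmemS _).1 (haS i))
    rw [if_pos ((hmemS i).2 hi)] at h2
    linarith
  have hle : ∀ k ∈ S, ∀ i ∈ S, x (a i) i ≤ x k i := fun k hk i _ => ha i k hk
  have hle1 : ∀ k, ∑ i ∈ S, x k i ≤ 1 := fun k => by
    rw [← (hx0' k).2]
    exact Finset.sum_le_sum_of_subset_of_nonneg (Finset.subset_univ _)
      fun i _ _ => (hx0' k).1 i
  have heq : ∀ k ∈ S, ∀ i ∈ S, x (a i) i = x k i := fun k hk =>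
    (Finset.sum_eq_sum_iff_of_le (hle k hk)).1
      (le_antisymm (Finset.sum_le_sum (hle k hk)) ((hle1 k).trans hsum))
  have hzero : ∀ k ∈ S, ∀ i, i ∉ S → x k i = 0 := by
    intro k hk i hi
    have h1 := (hx0' k).2
    rw [← Finset.sum_add_sum_compl S] at h1
    have h2 := hsum.trans (Finset.sum_le_sum (hle k hk))
    have h3 : ∑ i ∈ Sᶜ, x k i = 0 :=
      le_antisymm (by linarith) (Finset.sum_nonneg fun i _ => (hx0' k).1 i)
    exact (Finset.sum_eq_zero_iff_of_nonneg fun i _ => (hx0' k).1 i).1 h3 i (by simpa using hi)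
  obtain ⟨k₀, hk₀⟩ := hSne
  refine ⟨x k₀, hx0' k₀, fun i => ?_⟩
  by_cases hi : i ∈ S
  · have : x k₀ = x i := by
      ext j
      by_cases hj : j ∈ S
      · rw [← heq k₀ hk₀ j hj, ← heq i hi j hj]
      · rw [hzero k₀ hk₀ j hj, hzero i hi j hj]
    rw [this]
    exact hx1 i ((hmemS i).1 hi)
  · exact hface _ (hx0' k₀) i (hzero k₀ hk₀ i hi)

/-! ### Piecewise linear maps, handled through their graphs. -/

theorem sum_sub_ite_smul {X F : Type*} [AddCommGroup F] [Module ℝ F] [DecidableEq X]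
    {s t : Finset X} (hts : t ⊆ s)
    (w c : X → ℝ) (g : X → F) :
    ∑ v ∈ s, (w v - if v ∈ t then c v else 0) • g v =
      ∑ v ∈ s, w v • g v - ∑ v ∈ t, c v • g v := by
  simp only [sub_smul, Finset.sum_sub_distrib, ite_smul, zero_smul]
  rw [Finset.sum_ite_mem, Finset.inter_eq_right.2 hts]

section PiecewiseLinear

variable {E F : Type*} [AddCommGroup E] [Module ℝ E] [AddCommGroup F] [Module ℝ F]

/-- The graph of the piecewise linear map that extends the map `f` on the vertices of `T`. -/
def plGraph (T : Geometry.SimplicialComplex ℝ E) (f : E → F) : Set (E × F) :=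
  ⋃ s ∈ T.faces, convexHull ℝ ((fun v => (v, f v)) '' (s : Set E))

theorem exists_weights_of_mem_convexHull_graph {s : Finset E} {f : E → F} {p : E × F}
    (hp : p ∈ convexHull ℝ ((fun v => (v, f v)) '' (s : Set E))) :
    ∃ w : E → ℝ, (∀ v ∈ s, 0 ≤ w v) ∧ ∑ v ∈ s, w v = 1 ∧ ∑ v ∈ s, w v • v = p.1 ∧
      ∑ v ∈ s, w v • f v = p.2 := by
  let e : E ↪ E × F := ⟨fun v => (v, f v), fun a b h => congrArg Prod.fst h⟩
  have he : (fun v => (v, f v)) '' (s : Set E) = (s.map e : Finset (E × F)) := by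
    rw [Finset.coe_map]
    rfl
  rw [he, Finset.mem_convexHull'] at hp
  obtain ⟨w, h0, h1, h2⟩ := hp
  rw [Finset.sum_map] at h1 h2
  refine ⟨fun v => w (e v), fun v hv => h0 _ (Finset.mem_map_of_mem e hv), h1, ?_, ?_⟩
  · rw [← h2, Prod.fst_sum]
    rfl
  · rw [← h2, Prod.snd_sum]
    rfl

theorem mem_convexHull_of_mem_convexHull_graph {s : Set E} {f : E → F} {p : E × F}
    (hp : p ∈ convexHull ℝ ((fun v => (v, f v)) '' s)) :
    p.1 ∈ convexHull ℝ s ∧ p.2 ∈ convexHull ℝ (f '' s) := by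
  constructor
  · have := Set.mem_image_of_mem (LinearMap.fst ℝ E F) hp
    rw [LinearMap.image_convexHull, Set.image_image] at this
    exact (congrArg (p.1 ∈ convexHull ℝ ·) (Set.image_id' s)).mp this
  · have := Set.mem_image_of_mem (LinearMap.snd ℝ E F) hp
    rwa [LinearMap.image_convexHull, Set.image_image] at this

theorem exists_mem_convexHull_graph {s : Set E} (f : E → F) {x : E} (hx : x ∈ convexHull ℝ s) :
    ∃ z, (x, z) ∈ convexHull ℝ ((fun v => (v, f v)) '' s) := by
  have : LinearMap.fst ℝ E F '' convexHull ℝ ((fun v => (v, f v)) '' s) = convexHull ℝ s := by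
    rw [LinearMap.image_convexHull, Set.image_image]
    exact congrArg _ (Set.image_id' s)
  rw [← this] at hx
  obtain ⟨⟨x', z⟩, hp, rfl⟩ := hx
  exact ⟨z, hp⟩

/-- Barycentric coordinates are unique, so `w` is `c` extended by zero. -/
theorem AffineIndependent.sum_smul_eq_of_subset {s t : Finset E}
    (hs : AffineIndependent ℝ ((↑) : s → E)) (hts : t ⊆ s) {w c : E → ℝ}
    (hw : ∑ v ∈ s, w v = 1) (hc : ∑ v ∈ t, c v = 1)
    (hwc : ∑ v ∈ s, w v • v = ∑ v ∈ t, c v • v) (f : E → F) :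
    ∑ v ∈ s, w v • f v = ∑ v ∈ t, c v • f v := by
  classical
  let d : E → ℝ := fun v => w v - if v ∈ t then c v else 0
  have hd : ∀ v ∈ s, d v = 0 := by
    intro v hv
    refine (affineIndependent_iff.1 hs) s.attach (fun v => d v) ?_ ?_ ⟨v, hv⟩ (Finset.mem_attach _ _)
    · rw [Finset.sum_attach s d]
      have h1 : ∑ v ∈ s, d v = ∑ v ∈ s, w v - ∑ v ∈ t, c v := by
        simp only [d, Finset.sum_sub_distrib]
        rw [Finset.sum_ite_mem, Finset.inter_eq_right.2 hts]
      rw [h1, hw, hc, sub_self]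
    · rw [Finset.sum_attach s fun v => d v • v, sum_sub_ite_smul hts, hwc, sub_self]
  have : ∑ v ∈ s, d v • f v = _ := sum_sub_ite_smul hts w c f
  rw [Finset.sum_eq_zero fun v hv => by rw [hd v hv, zero_smul]] at this
  exact (sub_eq_zero.1 this.symm)

/-- Two simplices meet in the hull of their common vertices, so both values are computed from the
weights on those vertices. -/
theorem plGraph_functional {T : Geometry.SimplicialComplex ℝ E} {f : E → F} {x : E} {z z' : F}
    (hz : (x, z) ∈ plGraph T f) (hz' : (x, z') ∈ plGraph T f) : z = z' := by
  classical
  simp only [plGraph, Set.mem_iUnion] at hz hz'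
  obtain ⟨s, hs, hxs⟩ := hz
  obtain ⟨t, ht, hxt⟩ := hz'
  have hx := T.inter_subset_convexHull hs ht ⟨(mem_convexHull_of_mem_convexHull_graph hxs).1,
    (mem_convexHull_of_mem_convexHull_graph hxt).1⟩
  rw [← Finset.coe_inter, Finset.mem_convexHull'] at hx
  obtain ⟨c, -, hc1, hcx⟩ := hx
  obtain ⟨w, -, hw1, hwx, hwz⟩ := exists_weights_of_mem_convexHull_graph hxs
  obtain ⟨u, -, hu1, hux, huz⟩ := exists_weights_of_mem_convexHull_graph hxt
  have h1 := (T.indep hs).sum_smul_eq_of_subset Finset.inter_subset_left hw1 hc1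
    (hwx.trans hcx.symm) f
  have h2 := (T.indep ht).sum_smul_eq_of_subset Finset.inter_subset_right hu1 hc1
    (hux.trans hcx.symm) f
  exact hwz.symm.trans (h1.trans (h2.symm.trans huz))

/-- This takes the place of continuity: projections of closed parts of the graph are closed. -/
theorem isCompact_plGraph [TopologicalSpace E] [IsTopologicalAddGroup E] [ContinuousSMul ℝ E]
    [TopologicalSpace F] [IsTopologicalAddGroup F] [ContinuousSMul ℝ F]
    {T : Geometry.SimplicialComplex ℝ E} (hT : T.faces.Finite) (f : E → F) :
    IsCompact (plGraph T f) :=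
  hT.isCompact_biUnion fun s _ => (s.finite_toSet.image _).isCompact_convexHull (𝕜 := ℝ)

end PiecewiseLinear

/-- A piecewise linear map from a triangulation of the simplex which maps every facet of the
simplex to the corresponding coordinate hyperplane (after a permutation of the coordinates) attains
every nonnegative vector that has the coordinate sum of its values. -/
theorem exists_mem_plGraph {I : Type*} [Fintype I] [Nonempty I]
    {T : Geometry.SimplicialComplex ℝ (I → ℝ)} (hT : T.faces.Finite)
    (hspace : T.space = stdSimplex ℝ I) {f : (I → ℝ) → I → ℝ} {a : ℝ}
    (hf : ∀ v ∈ T.vertices, ∑ i, f v i = a) (π : I ≃ I)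
    (hface : ∀ v ∈ T.vertices, ∀ i, v i = 0 → f v (π i) = 0)
    {y : I → ℝ} (hy0 : ∀ i, 0 ≤ y i) (hy : ∑ i, y i = a) :
    ∃ x, (x, y) ∈ plGraph T f := by
  have hvert : ∀ s ∈ T.faces, ∀ v ∈ s, v ∈ T.vertices := fun s hs v hv =>
    T.down_closed hs (Finset.singleton_subset_iff.2 hv) (Finset.singleton_nonempty v)
  have hsumG : ∀ x z, (x, z) ∈ plGraph T f → ∑ i, z i = a := by
    intro x z hxz
    simp only [plGraph, Set.mem_iUnion] at hxz
    obtain ⟨s, hs, hxs⟩ := hxz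
    obtain ⟨w, -, hw1, -, rfl⟩ := exists_weights_of_mem_convexHull_graph hxs
    simp only [Finset.sum_apply, Pi.smul_apply, smul_eq_mul]
    rw [Finset.sum_comm]
    simp only [← Finset.mul_sum]
    rw [Finset.sum_congr rfl fun v hv => by rw [hf v (hvert s hs v hv)], ← Finset.sum_mul, hw1,
      one_mul]
  have hfaceG : ∀ x z, (x, z) ∈ plGraph T f → ∀ i, x i = 0 → z (π i) = 0 := by
    intro x z hxz i hi
    simp only [plGraph, Set.mem_iUnion] at hxz
    obtain ⟨s, hs, hxs⟩ := hxz
    obtain ⟨w, hw0, -, rfl, rfl⟩ := exists_weights_of_mem_convexHull_graph hxs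
    simp only [Finset.sum_apply, Pi.smul_apply, smul_eq_mul] at hi ⊢
    have hnn : ∀ v ∈ s, 0 ≤ v i := fun v hv =>
      (hspace ▸ T.vertices_subset_space (hvert s hs v hv) : v ∈ stdSimplex ℝ I).1 i
    rw [Finset.sum_eq_zero_iff_of_nonneg fun v hv => mul_nonneg (hw0 v hv) (hnn v hv)] at hi
    refine Finset.sum_eq_zero fun v hv => ?_
    rcases mul_eq_zero.1 (hi v hv) with h | h
    · rw [h, zero_mul]
    · rw [hface v (hvert s hs v hv) i h, mul_zero]
  have hex : ∀ x ∈ stdSimplex ℝ I, ∃ z, (x, z) ∈ plGraph T f := by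
    intro x hx
    rw [← hspace, Geometry.SimplicialComplex.mem_space_iff] at hx
    obtain ⟨s, hs, hxs⟩ := hx
    obtain ⟨z, hz⟩ := exists_mem_convexHull_graph f hxs
    exact ⟨z, Set.mem_biUnion hs hz⟩
  -- These sets cover because the image and `y` have equal coordinate sums, so some coordinate of
  -- the image is at most that of `y`.
  obtain ⟨x, hx, hxB⟩ := exists_mem_of_closed_cover
    (fun i => Prod.fst '' (plGraph T f ∩ {p | p.2 (π i) ≤ y (π i)}))
    (fun i => (((isCompact_plGraph hT f).inter_right
      (isClosed_le (by fun_prop) continuous_const)).image continuous_fst).isClosed)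
    (fun x hx => by
      obtain ⟨z, hz⟩ := hex x hx
      obtain ⟨i, -, hi⟩ := Finset.exists_le_of_sum_le (s := Finset.univ) (f := z) (g := y)
        Finset.univ_nonempty (by rw [hsumG x z hz, hy])
      exact ⟨π.symm i, (x, z), ⟨hz, by simpa using hi⟩, rfl⟩)
    (fun x hx i hi => by
      obtain ⟨z, hz⟩ := hex x hx
      exact ⟨(x, z), ⟨hz, by simpa [hfaceG x z hz i hi] using hy0 (π i)⟩, rfl⟩)
  obtain ⟨z, hz⟩ := hex x hx
  have hle : ∀ i, z i ≤ y i := by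
    intro i
    obtain ⟨⟨x', z'⟩, ⟨hz', hle⟩, rfl⟩ := hxB (π.symm i)
    rw [plGraph_functional hz hz']
    simpa using hle
  have : z = y := funext fun i => (Finset.sum_eq_sum_iff_of_le fun i _ => hle i).1
    ((hsumG x z hz).trans hy.symm) i (Finset.mem_univ i)
  exact ⟨x, this ▸ hz⟩

/-! ### Label counts of Sperner labelings, and the main theorem. -/

theorem mem_convexHull_stdVertex_of_apply_eq_zero {n : ℕ} {v : Fin (n + 1) → ℝ}
    (hv : v ∈ stdSimplex ℝ (Fin (n + 1))) {i : Fin (n + 1)} (hi : v i = 0) :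
    v ∈ convexHull ℝ (stdVertex n '' ((Finset.univ.erase i : Finset _) : Set (Fin (n + 1)))) := by
  have h1 : ∑ j ∈ Finset.univ.erase i, v j = 1 := by
    rw [← hv.2, ← Finset.add_sum_erase _ _ (Finset.mem_univ i), hi, zero_add]
  have h2 : ∑ j ∈ Finset.univ.erase i, v j • stdVertex n j = v := by
    have h3 := pi_eq_sum_univ' v
    rw [← Finset.add_sum_erase _ _ (Finset.mem_univ i), hi, zero_smul, zero_add] at h3
    conv_rhs => rw [h3]
    rfl
  rw [← h2]
  exact (convex_convexHull ℝ _).sum_mem (fun j _ => hv.1 j) h1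
    fun j hj => subset_convexHull ℝ _ ⟨j, hj, rfl⟩

theorem labelCount_mem_latticePoints {n m : ℕ} (L : Fin m → (Fin (n + 1) → ℝ) → Fin (n + 1))
    (v : Fin (n + 1) → ℝ) : labelCount L v ∈ latticePoints n m := by
  refine ⟨⟨fun i => Nat.cast_nonneg _, ?_⟩, fun i => ⟨_, (Int.cast_natCast _).symm⟩⟩
  have := Finset.card_eq_sum_card_fiberwise (f := fun k => L k v) (s := Finset.univ)
    (t := Finset.univ) (by simp)
  rw [Finset.card_univ, Fintype.card_fin] at this
  simp only [labelCount]
  exact_mod_cast this.symm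

/-- On the facet opposite `stdVertex n i`, only labels of the other original vertices are allowed,
and these differ from `π i`. -/
theorem labelCount_apply_eq_zero {n m : ℕ} {T : Geometry.SimplicialComplex ℝ (Fin (n + 1) → ℝ)}
    (hspace : T.space = stdSimplex ℝ (Fin (n + 1)))
    {L : Fin m → (Fin (n + 1) → ℝ) → Fin (n + 1)} (hL : ∀ k, IsSpernerLabeling T (L k))
    {π : Fin (n + 1) → Fin (n + 1)} (hπ : ∀ k i, L k (stdVertex n i) = π i)
    {v : Fin (n + 1) → ℝ} (hv : v ∈ T.vertices) {i : Fin (n + 1)} (hi : v i = 0) :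
    labelCount L v (π i) = 0 := by
  have hvs : v ∈ stdSimplex ℝ (Fin (n + 1)) := hspace ▸ T.vertices_subset_space hv
  simp only [labelCount, Nat.cast_eq_zero, Finset.card_eq_zero, Finset.filter_eq_empty_iff,
    Finset.mem_univ, true_imp_iff]
  intro k hk
  obtain ⟨j, hj, hjv⟩ := (hL k).mem_face _ v hv (mem_convexHull_stdVertex_of_apply_eq_zero hvs hi)
  rw [hk, ← hπ k i] at hjv
  exact Finset.ne_of_mem_erase hj ((hL k).distinct hjv).symm

theorem exists_equiv_label_stdVertex {n m : ℕ} {T : Geometry.SimplicialComplex ℝ (Fin (n + 1) → ℝ)}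
    {L : Fin m → (Fin (n + 1) → ℝ) → Fin (n + 1)} (hL : ∀ k, IsSpernerLabeling T (L k))
    (hagree : ∀ k k' i, L k (stdVertex n i) = L k' (stdVertex n i)) :
    ∃ π : Fin (n + 1) ≃ Fin (n + 1), ∀ k i, L k (stdVertex n i) = π i := by
  cases m with
  -- Without labelings any permutation serves.
  | zero => exact ⟨Equiv.refl _, fun k => k.elim0⟩
  | succ m =>
    exact ⟨Equiv.ofBijective _ (Finite.injective_iff_bijective.1 (hL 0).distinct),
      fun k i => hagree k 0 i⟩

theorem Geometry.SimplicialComplex.exists_facet_ge {E : Type*} [AddCommGroup E] [Module ℝ E]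
    {T : Geometry.SimplicialComplex ℝ E} (hT : T.faces.Finite) {s : Finset E} (hs : s ∈ T.faces) :
    ∃ σ ∈ T.facets, s ⊆ σ := by
  obtain ⟨σ, hsσ, hσ⟩ := hT.exists_le_maximal hs
  exact ⟨σ, ⟨hσ.prop, fun t ht h => h.antisymm (hσ.le_of_ge ht h)⟩, hsσ⟩

theorem theorem2 (n m : ℕ) (T : Geometry.SimplicialComplex ℝ (Fin (n + 1) → ℝ))
    (hT : IsTriangulation n T)
    (L : Fin m → (Fin (n + 1) → ℝ) → Fin (n + 1))
    (hL : ∀ k, IsSpernerLabeling T (L k))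
    (hagree : ∀ k k' i, L k (stdVertex n i) = L k' (stdVertex n i))
    (y : Fin (n + 1) → ℝ) (hy : y ∈ scaledSimplex n m)
    (hgen : ∀ p : Fin n → Fin (n + 1) → ℝ, (∀ a, p a ∈ latticePoints n m) →
      y ∉ convexHull ℝ (Set.range p)) :
    ∃ σ ∈ T.facets, ∃ v : Fin (n + 1) → Fin (n + 1) → ℝ,
      Function.Injective v ∧ Set.range v = (σ : Set (Fin (n + 1) → ℝ)) ∧
      (∀ i, labelCount L (v i) ∈ latticePoints n m) ∧
      y ∈ convexHull ℝ (Set.range fun i => labelCount L (v i)) := by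
  obtain ⟨π, hπ⟩ := exists_equiv_label_stdVertex hL hagree
  obtain ⟨x, hx⟩ := exists_mem_plGraph hT.finite hT.space_eq
    (fun v _ => (labelCount_mem_latticePoints L v).1.2) π
    (fun v hv i hi => labelCount_apply_eq_zero hT.space_eq hL hπ hv hi) hy.1 hy.2
  simp only [plGraph, Set.mem_iUnion] at hx
  obtain ⟨s, hs, hxs⟩ := hx
  -- The simplex `s` found by surjectivity may be a lower-dimensional face; passing to a facet only
  -- enlarges the hull, and any enumeration of its vertices will do.
  obtain ⟨σ, hσ, hsσ⟩ := Geometry.SimplicialComplex.exists_facet_ge hT.finite hs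
  let e := (Finset.equivFinOfCardEq (hT.pure σ hσ)).symm
  have hrange : Set.range (fun i => (e i : Fin (n + 1) → ℝ)) = σ := by
    have := e.surjective.range_comp ((↑) : σ → Fin (n + 1) → ℝ)
    rwa [Subtype.range_coe_subtype] at this
  refine ⟨σ, hσ, fun i => e i, Subtype.val_injective.comp e.injective, hrange,
    fun i => labelCount_mem_latticePoints L _, ?_⟩
  refine convexHull_mono ?_ (mem_convexHull_of_mem_convexHull_graph hxs).2
  have h := Set.range_comp (labelCount L) fun i => (e i : Fin (n + 1) → ℝ)
  rw [hrange] at h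
  exact (Set.image_mono hsσ).trans h.ge
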